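/- **Setting.** Let $q,d\in\mathbb N$. On a probability space consider the following objects. *Graph.* For agents $i\in\{1,\dots,q\}$ and objects $j\in\{1,\dots,d\}$ let the events $\{i\sim j\}$ be independent with $\mathbb P(i\sim j)=p_{ij}\in[0,1]$, and let $\deg(j)=\sum_{i=1}^q \mathbf 1(i\sim j)$. *Claims.* Let $\alpha>0$, $K_1,\dots,K_d>0$, and let $V=(V_1,\dots,V_d)$ be a random vector with nonnegative components and $\mathbb P(V_j>t)\sim K_jt^{-\alpha}$ as $t\to\infty$ for every $j$. Assume that $V$ is multivariate regularly varying with exponent measure $\nu$, i.e. $\nu\neq0$ is a Radon measure on $[0,\infty]^d\setminus\{0\}$ and $n\,\mathbb P(n^{-1/\alpha}V\in\cdot)\to\nu$ vaguely on $[0,\infty]^d\setminus\{0\}$ as $n\to\infty$. The claims are called *asymptotically independent* if $\nu$ is concentrated on the coordinate axes, and *asymptotically fully dependent* if $\nu$ is concentrated on the ray $\{s(K_1^{1/\alpha},\dots,K_d^{1/\alpha}):s>0\}$. The random graph is independent of $V$. For a random $q\times d$ matrix $A$ put $$B_{\rm ind}(A)=\sum_{j=1}^d K_j\,\mathbb E\Big(1-\sum_{i=1}^qA_{ij}\Big)^{\alpha},\qquad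 B_{\rm dep}(A)=\mathbb E\Big(\sum_{j=1}^dK_j^{1/\alpha}\Big(1-\sum_{i=1}^qA_{ij}\Big)\Big)^{\alpha}.$$ Here $f\sim g$ means $f(t)/g(t)\to1$ as $t\to\infty$; in the degenerate case $g\equiv0$ it means that $f(t)=0$ for all large $t$. **Proposition.** (1) Let $A_{ij}=\mathbf 1(i\sim j)W_{ij}$ with random weights $W_{ij}\ge0$, possibly depending on the graph, such that almost surely $0<\sum_{i=1}^qW_{ij}\le1$ for all $j$, and such that $A$ is independent of $V$. Then $$\mathbb P\Big(\sum_{j=1}^d\Big(1-\sum_{i=1}^q \mathbf 1(i\sim j)W_{ij}\Big)V_j\ge t\Big)\sim B\,t^{-\alpha},\qquad t\to\infty,$$ with $B=B_{\rm ind}(A)$ if the claims are asymptotically independent, and $B=B_{\rm dep}(A)$ if they are asymptotically fully dependent. (2) For equal splitting, $A_{ij}=\mathbf 1(i\sim j)/\deg(j)$ with $0/0:=0$, one likewise has $$\mathbb P\Big(\sum_{j=1}^d\Big(1-\sum_{i=1}^q A_{ij}\Big)V_j\ge t\Big)\sim B\,t^{-\alpha},\qquad t\to\infty,$$ with $B=B_{\rm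 ind}(A)$, respectively $B=B_{\rm dep}(A)$, in the two cases, and $$B_{\rm ind}(A)=\sum_{j=1}^dK_j\prod_{i=1}^q(1-p_{ij}),$$ $$B_{\rm dep}(A)=\sum_{(n_1,\dots,n_d)\in\{0,1\}^d}\ \prod_{j=1}^d\Big(\prod_{i=1}^q(1-p_{ij})\Big)^{n_j}\Big(1-\prod_{i=1}^q(1-p_{ij})\Big)^{1-n_j}\ \Big(\sum_{j=1}^dK_j^{1/\alpha}n_j\Big)^{\alpha}.$$ -/

import Mathlib

open MeasureTheory ProbabilityTheory Filter Topology Asymptotics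
open scoped ENNReal

namespace ReinsuranceNetwork

noncomputable section

/-! ### Multivariate regular variation -/

/-- The punctured compactified orthant `[0,∞]^d \ {0}`, with the topology and the Borel σ-algebra
inherited from `[0,∞]^d`.  Its compact subsets are the compact subsets of `[0,∞]^d` that do not
contain the origin. -/
abbrev PuncturedOrthant (d : ℕ) : Type := {x : Fin d → ℝ≥0∞ // x ≠ 0}

/-- Vague convergence of a sequence of measures: convergence of the integrals of all continuous
functions with compact support. -/
def VagueTendsto {X : Type*} [TopologicalSpace X] [MeasurableSpace X]
    (ν : ℕ → Measure X) (ν' : Measure X) : Prop :=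
  ∀ f : X → ℝ, Continuous f → HasCompactSupport f →
    Tendsto (fun n => ∫ x, f x ∂(ν n)) atTop (𝓝 (∫ x, f x ∂ν'))

/-- The measure `S ↦ ℙ(X / b ∈ S)` on the Borel subsets of `[0,∞]^d \ {0}`, for a random vector `X`
with nonnegative components. -/
def scaledLaw {Ω : Type*} [MeasurableSpace Ω] (P : Measure Ω) {d : ℕ}
    (X : Ω → Fin d → ℝ) (b : ℝ) : Measure (PuncturedOrthant d) :=
  (P.map fun ω j => ENNReal.ofReal (X ω j / b)).comap Subtype.val

/-- The random vector `X` with nonnegative components is multivariate regularly varying with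
exponent measure `ν` for the normalization `b_n = n^{1/α}`: the measure `ν` is a nonzero Radon
measure on `[0,∞]^d \ {0}` and `n ℙ(X / n^{1/α} ∈ ·)` converges vaguely to `ν`. -/
structure IsExponentMeasure {Ω : Type*} [MeasurableSpace Ω] (P : Measure Ω) {d : ℕ}
    (X : Ω → Fin d → ℝ) (α : ℝ) (ν : Measure (PuncturedOrthant d)) : Prop where
  radon : IsFiniteMeasureOnCompacts ν
  ne_zero : ν ≠ 0
  vague : VagueTendsto (fun n : ℕ => (n : ℝ≥0∞) • scaledLaw P X ((n : ℝ) ^ (1 / α))) ν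

/-- Asymptotic independence: the exponent measure only has mass on the coordinate axes. -/
def AsympIndependent {d : ℕ} (ν : Measure (PuncturedOrthant d)) : Prop :=
  ν {x | ∃ j, ∀ k, k ≠ j → x.1 k = 0}ᶜ = 0

/-- Asymptotic full dependence: the exponent measure only has mass on the ray
`{s (K_1^{1/α}, …, K_d^{1/α}) : s > 0}`. -/
def AsympFullyDependent {d : ℕ} (α : ℝ) (K : Fin d → ℝ)
    (ν : Measure (PuncturedOrthant d)) : Prop :=
  ν {x | ∃ s : ℝ, 0 < s ∧ ∀ j, x.1 j = ENNReal.ofReal (s * K j ^ (1 / α))}ᶜ = 0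

/-- Joint assumptions on the claims: a random vector with nonnegative components and Pareto tails
`ℙ(V_j > t) ∼ K_j t^{-α}`, multivariate regularly varying with exponent measure `ν`. -/
structure IsParetoClaims {Ω : Type*} [MeasurableSpace Ω] (P : Measure Ω) {d : ℕ}
    (V : Ω → Fin d → ℝ) (α : ℝ) (K : Fin d → ℝ) (ν : Measure (PuncturedOrthant d)) : Prop where
  measurable : Measurable V
  nonneg : ∀ᵐ ω ∂P, ∀ j, 0 ≤ V ω j
  pareto : ∀ j, (fun t : ℝ => P.real {ω | t < V ω j}) ~[atTop] fun t => K j * t ^ (-α)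
  exponent : IsExponentMeasure P V α ν

/-! ### The random bipartite graph and the market matrix -/

/-- `E i j` is the event `i ∼ j` that agent `i` insures object `j`.  All these events are
independent, and `i ∼ j` has probability `p i j`. -/
structure IsRandomBipartiteGraph {Ω : Type*} [MeasurableSpace Ω] (P : Measure Ω) {q d : ℕ}
    (p : Fin q → Fin d → ℝ) (E : Fin q → Fin d → Set Ω) : Prop where
  measurableSet : ∀ i j, MeasurableSet (E i j)
  prob : ∀ i j, P.real (E i j) = p i j
  indep : iIndepSet (fun ij : Fin q × Fin d => E ij.1 ij.2) P

/-- The adjacency matrix with entries `1(i ∼ j)`. -/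
def edge {Ω : Type*} {q d : ℕ} (E : Fin q → Fin d → Set Ω) (ω : Ω) (i : Fin q) (j : Fin d) : ℝ :=
  (E i j).indicator 1 ω

/-- The number of agents insuring object `j`. -/
def deg {Ω : Type*} {q d : ℕ} (E : Fin q → Fin d → Set Ω) (ω : Ω) (j : Fin d) : ℝ :=
  ∑ i, edge E ω i j

/-- The market matrix `A_ij = 1(i ∼ j) W_ij`. -/
def marketMatrix {Ω : Type*} {q d : ℕ} (E : Fin q → Fin d → Set Ω)
    (W : Ω → Fin q → Fin d → ℝ) (ω : Ω) (i : Fin q) (j : Fin d) : ℝ :=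
  edge E ω i j * W ω i j

/-- Equal splitting `A_ij = 1(i ∼ j) / deg(j)`, with `0 / 0 = 0`. -/
def equalSplit {Ω : Type*} {q d : ℕ} (E : Fin q → Fin d → Set Ω)
    (ω : Ω) (i : Fin q) (j : Fin d) : ℝ :=
  edge E ω i j / deg E ω j

/-- The uninsured proportion `1 - ∑_i A_ij` of object `j`. -/
def uninsuredShare {Ω : Type*} {q d : ℕ} (A : Ω → Fin q → Fin d → ℝ) (ω : Ω) (j : Fin d) : ℝ :=
  1 - ∑ i, A ω i j

/-- The uninsured loss `∑_j (1 - ∑_i A_ij) V_j`. -/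
def uninsuredLoss {Ω : Type*} {q d : ℕ} (A : Ω → Fin q → Fin d → ℝ) (V : Ω → Fin d → ℝ)
    (ω : Ω) : ℝ :=
  ∑ j, uninsuredShare A ω j * V ω j

/-- The constant `B_ind = ∑_j K_j 𝔼 (1 - ∑_i A_ij)^α`. -/
def Bind {Ω : Type*} [MeasurableSpace Ω] (P : Measure Ω) {q d : ℕ} (α : ℝ) (K : Fin d → ℝ)
    (A : Ω → Fin q → Fin d → ℝ) : ℝ :=
  ∑ j, K j * ∫ ω, uninsuredShare A ω j ^ α ∂P

/-- The constant `B_dep = 𝔼 (∑_j K_j^{1/α} (1 - ∑_i A_ij))^α`. -/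
def Bdep {Ω : Type*} [MeasurableSpace Ω] (P : Measure Ω) {q d : ℕ} (α : ℝ) (K : Fin d → ℝ)
    (A : Ω → Fin q → Fin d → ℝ) : ℝ :=
  ∫ ω, (∑ j, K j ^ (1 / α) * uninsuredShare A ω j) ^ α ∂P

/-- The uninsured loss has tail `ℙ(∑_j (1 - ∑_i A_ij) V_j ≥ t) ∼ B t^{-α}` as `t → ∞`. -/
def UninsuredTail {Ω : Type*} [MeasurableSpace Ω] (P : Measure Ω) {q d : ℕ}
    (A : Ω → Fin q → Fin d → ℝ) (V : Ω → Fin d → ℝ) (α B : ℝ) : Prop :=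
  (fun t : ℝ => P.real {ω | t ≤ uninsuredLoss A V ω}) ~[atTop] fun t => B * t ^ (-α)

end

end ReinsuranceNetwork

/-!
The uninsured loss is `∑_j Y_j V_j`, where the vector `Y` of uninsured shares takes values in
`[0, 1]^d` and is independent of the claims `V`.  Conditioning on `Y`
(`measureReal_le_sum_mul_eq_integral`) reduces the tail asymptotics to deterministic weights `y ≥ 0`:
once `t^α ℙ(∑_j y_j V_j ≥ t) → c(y)` is known for every `y`, dominated convergence gives the constant
`𝔼 c(Y)` (`IsParetoClaims.isEquivalent_tail_of_forall`).  The dominating constant comes from the case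
`y = (1, …, 1)`, and if `𝔼 c(Y) = 0` then `Y = 0` almost surely, so the loss vanishes.

For deterministic weights the exponent measure is needed only to show that certain events have
probability `o(t^{-α})` (`IsParetoClaims.tendsto_negligible`): a continuous compactly supported
function that vanishes `ν`-almost everywhere dominates their indicators.  Under asymptotic
independence these are the events that two components both exceed `ε t`; the sum is then large
exactly when one term is, and the tails `K_j y_j^α t^{-α}` add up.  Under full dependence they are the
events that `V_i ≥ a K_i^{1/α} t` while `V_j ≤ b K_j^{1/α} t` with `b < a`; the sum is then comparable
to `(∑_j K_j^{1/α} y_j) V_l / K_l^{1/α}` for any single `l`.  In both cases the limit is obtained by a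
squeeze in which the threshold is rescaled by a factor tending to `1` (`tendsto_of_scaled_bounds`).

Under equal splitting an object is uninsured exactly when no edge reaches it, and otherwise it is
insured completely.  The events `isolated E j` are independent with probabilities
`∏_i (1 - p_ij)`, and summing over the possible patterns yields the explicit constants.
-/

namespace ReinsuranceNetwork

/-! ### Events of negligible probability -/

theorem isCompact_setOf_le_apply {d : ℕ} (i : Fin d) {a : ℝ≥0∞} (ha : 0 < a) :
    IsCompact {x : PuncturedOrthant d | a ≤ x.1 i} := by
  have hK : IsCompact {x : Fin d → ℝ≥0∞ | a ≤ x i} :=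
    (isClosed_le continuous_const (continuous_apply i)).isCompact
  refine (Topology.IsInducing.isCompact_preimage_iff
    (Topology.IsInducing.subtypeVal (t := {x : Fin d → ℝ≥0∞ | x ≠ 0})) ?_).2 hK
  intro x hx
  rw [Subtype.range_coe_subtype]
  rintro rfl
  exact absurd hx (by simpa using ha.ne')

theorem continuous_mul_comp_apply {d : ℕ} {g h : ℝ≥0∞ → ℝ} (hg : Continuous g) (hh : Continuous h)
    (i j : Fin d) : Continuous fun x : PuncturedOrthant d => g (x.1 i) * h (x.1 j) :=
  (hg.comp ((continuous_apply i).comp continuous_subtype_val)).mul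
    (hh.comp ((continuous_apply j).comp continuous_subtype_val))

theorem tendsto_div_floor_rpow {α : ℝ} (hα : 0 < α) :
    Tendsto (fun t : ℝ => t ^ α / (⌊t ^ α⌋₊ : ℝ)) atTop (𝓝 1) := by
  have h := (tendsto_nat_floor_div_atTop (R := ℝ)).comp (tendsto_rpow_atTop hα)
  simpa [Function.comp_def] using h.inv₀ one_ne_zero

section Negligible

variable {Ω : Type*} [MeasurableSpace Ω] {P : Measure Ω} [IsProbabilityMeasure P] {d : ℕ}
  {V : Ω → Fin d → ℝ} {α : ℝ} {K : Fin d → ℝ} {ν : Measure (PuncturedOrthant d)}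

/-- Markov's inequality for the scaled law, with a test function `g (x i) * h (x j)`. -/
theorem measureReal_le_integral_scaledLaw (hVm : Measurable V) {i j : Fin d} {g h : ℝ≥0∞ → ℝ}
    (hg : Continuous g) (hh : Continuous h)
    (hg01 : ∀ x, g x ∈ Set.Icc 0 1) (hh01 : ∀ x, h x ∈ Set.Icc 0 1) (hg0 : g 0 = 0) (b : ℝ) :
    P.real {ω | g (.ofReal (V ω i / b)) = 1 ∧ h (.ofReal (V ω j / b)) = 1} ≤
      ∫ x, g (x.1 i) * h (x.1 j) ∂(scaledLaw P V b) := by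
  have hφ : Measurable fun ω (k : Fin d) => ENNReal.ofReal (V ω k / b) := by fun_prop
  have hemb : MeasurableEmbedding (Subtype.val : PuncturedOrthant d → Fin d → ℝ≥0∞) :=
    MeasurableEmbedding.subtype_coe (measurableSet_singleton 0).compl
  have : IsFiniteMeasure (scaledLaw P V b) := by
    refine ⟨?_⟩
    rw [scaledLaw, hemb.comap_apply]
    have := Measure.isProbabilityMeasure_map (μ := P) hφ.aemeasurable
    exact measure_lt_top _ _
  have hf0 : ∀ x : PuncturedOrthant d, 0 ≤ g (x.1 i) * h (x.1 j) :=
    fun x => mul_nonneg (hg01 _).1 (hh01 _).1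
  have hfc := continuous_mul_comp_apply hg hh i j
  have hint : Integrable (fun x : PuncturedOrthant d => g (x.1 i) * h (x.1 j))
      (scaledLaw P V b) := by
    refine Integrable.of_bound hfc.measurable.aestronglyMeasurable 1 (ae_of_all _ fun x => ?_)
    rw [Real.norm_of_nonneg (hf0 x)]
    exact mul_le_one₀ (hg01 _).2 (hh01 _).1 (hh01 _).2
  have hM := mul_meas_ge_le_integral_of_nonneg (ae_of_all _ hf0) hint 1
  rw [one_mul] at hM
  refine le_trans ?_ hM
  have hS : MeasurableSet {x : PuncturedOrthant d | 1 ≤ g (x.1 i) * h (x.1 j)} :=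
    measurableSet_le measurable_const hfc.measurable
  rw [measureReal_def, measureReal_def, scaledLaw, hemb.comap_apply,
    Measure.map_apply hφ (hemb.measurableSet_image.2 hS)]
  refine ENNReal.toReal_mono (measure_ne_top _ _) (measure_mono ?_)
  rintro ω ⟨h1, h2⟩
  refine ⟨⟨fun k => ENNReal.ofReal (V ω k / b), fun h0 => ?_⟩, ?_, rfl⟩
  · have := congrFun h0 i
    simp only [Pi.zero_apply] at this
    rw [this, hg0] at h1
    exact zero_ne_one h1
  · simp [h1, h2]

/-- If a test function `g (x i) * h (x j)` vanishes `ν`-almost everywhere and equals `1` on the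
dilates of `D` by all factors in `[1, R]`, then `ℙ(V / t ∈ D) = o(t^{-α})`.  The dilations bridge the
gap between real `t` and the normalizing sequence `n^{1/α}` of the vague convergence. -/
theorem IsParetoClaims.tendsto_negligible (hV : IsParetoClaims P V α K ν) (hα : 0 < α)
    (i j : Fin d) {g h : ℝ≥0∞ → ℝ} (hg : Continuous g) (hh : Continuous h)
    (hg01 : ∀ x, g x ∈ Set.Icc 0 1) (hh01 : ∀ x, h x ∈ Set.Icc 0 1)
    {a : ℝ≥0∞} (ha : 0 < a) (hg0 : ∀ x ≤ a, g x = 0)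
    (hnull : ∀ᵐ x ∂ν, g (x.1 i) * h (x.1 j) = 0) {R : ℝ} (hR : 1 < R) {D : Set (Fin d → ℝ)}
    (hD : ∀ x ∈ D, ∀ r ∈ Set.Icc 1 R, g (.ofReal (r * x i)) = 1 ∧ h (.ofReal (r * x j)) = 1) :
    Tendsto (fun t : ℝ => t ^ α * P.real {ω | t⁻¹ • V ω ∈ D}) atTop (𝓝 0) := by
  have hcs : HasCompactSupport fun x : PuncturedOrthant d => g (x.1 i) * h (x.1 j) := by
    refine HasCompactSupport.intro (isCompact_setOf_le_apply i ha) fun x hx => ?_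
    rw [hg0 _ (not_le.1 hx).le, zero_mul]
  have hn := hV.exponent.vague _ (continuous_mul_comp_apply hg hh i j) hcs
  rw [integral_eq_zero_of_ae hnull] at hn
  have hfl : Tendsto (fun t : ℝ => ⌊t ^ α⌋₊) atTop atTop :=
    tendsto_nat_floor_atTop.comp (tendsto_rpow_atTop hα)
  have hlim := (hn.comp hfl).const_mul (R ^ α)
  rw [mul_zero] at hlim
  have hRα : 1 < R ^ α := Real.one_lt_rpow hR hα
  refine squeeze_zero' ?_ ?_ hlim
  · filter_upwards [eventually_ge_atTop 0] with t ht
    positivity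
  filter_upwards [eventually_gt_atTop 0, hfl.eventually_ge_atTop 1,
    (tendsto_div_floor_rpow hα).eventually_lt_const hRα] with t ht hn1 htR
  -- `s = n^{1/α}` is the last normalization not exceeding `t`, and `t / s ≤ R` since `t` is large
  set n := ⌊t ^ α⌋₊ with hndef
  have hn0 : (0 : ℝ) < n := by exact_mod_cast hn1
  have hle : t ^ α ≤ R ^ α * n := by rw [div_lt_iff₀ hn0] at htR; exact htR.le
  have hnt : (n : ℝ) ≤ t ^ α := Nat.floor_le (by positivity)
  set s : ℝ := (n : ℝ) ^ (1 / α) with hs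
  have hs0 : 0 < s := by positivity
  have hsα : s ^ α = n := by
    rw [hs, ← Real.rpow_mul hn0.le, one_div_mul_cancel hα.ne', Real.rpow_one]
  have hr : t / s ∈ Set.Icc 1 R := by
    constructor
    · rw [one_le_div hs0, ← Real.rpow_le_rpow_iff hs0.le ht.le hα, hsα]
      exact hnt
    · rw [div_le_iff₀ hs0, ← Real.rpow_le_rpow_iff ht.le (by positivity) hα,
        Real.mul_rpow (by positivity) hs0.le, hsα]
      exact hle
  have hsub : P.real {ω | t⁻¹ • V ω ∈ D} ≤
      P.real {ω | g (.ofReal (V ω i / s)) = 1 ∧ h (.ofReal (V ω j / s)) = 1} := by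
    refine measureReal_mono fun ω hω => ?_
    have h1 := hD _ hω _ hr
    have h2 : ∀ k, t / s * (t⁻¹ • V ω) k = V ω k / s := fun k => by
      simp only [Pi.smul_apply, smul_eq_mul]
      field_simp
    rwa [h2, h2] at h1
  have hM := measureReal_le_integral_scaledLaw (P := P) (i := i) (j := j) hV.measurable hg hh
    hg01 hh01 (hg0 0 zero_le) s
  simp only [Function.comp_apply, ← hndef, integral_smul_measure, ENNReal.toReal_natCast,
    smul_eq_mul]
  calc t ^ α * P.real {ω | t⁻¹ • V ω ∈ D} ≤ (R ^ α * n) * _ :=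
        mul_le_mul hle (hsub.trans hM) measureReal_nonneg (by positivity)
    _ = _ := by rw [mul_assoc]

/-- Under asymptotic independence two components are jointly large with negligible probability. -/
theorem IsParetoClaims.tendsto_joint_exceedance (hV : IsParetoClaims P V α K ν) (hα : 0 < α)
    (hind : AsympIndependent ν) {i j : Fin d} (hij : i ≠ j) {ε : ℝ} (hε : 0 < ε) :
    Tendsto (fun t : ℝ => t ^ α * P.real {ω | ε * t ≤ V ω i ∧ ε * t ≤ V ω j}) atTop (𝓝 0) := by
  have hlt : ENNReal.ofReal (ε / 2) < ENNReal.ofReal ε :=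
    (ENNReal.ofReal_lt_ofReal_iff hε).2 (half_lt_self hε)
  obtain ⟨g, hg0, hg1, hg01⟩ := exists_continuous_zero_one_of_isClosed
    (isClosed_Iic (a := ENNReal.ofReal (ε / 2))) (isClosed_Ici (a := ENNReal.ofReal ε))
    (Set.disjoint_left.2 fun x hx hx' => absurd (le_trans hx' hx) (not_le.2 hlt))
  have h := hV.tendsto_negligible hα i j g.continuous g.continuous hg01 hg01
    (ENNReal.ofReal_pos.2 (half_pos hε)) (fun x hx => hg0 hx) ?_ one_lt_two
    (D := {x | ε ≤ x i ∧ ε ≤ x j}) ?_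
  · refine h.congr' ?_
    filter_upwards [eventually_gt_atTop 0] with t ht
    simp only [Pi.smul_apply, smul_eq_mul, inv_mul_eq_div, le_div_iff₀ ht]
  · have : ∀ᵐ x ∂ν, ∃ j, ∀ k, k ≠ j → x.1 k = 0 := hind
    filter_upwards [this] with x ⟨l, hl⟩
    by_cases hil : i = l
    · rw [hl j (by rw [← hil]; exact hij.symm), hg0 (x := 0) (by simp)]
      simp
    · rw [hl i hil, hg0 (x := 0) (by simp)]
      simp
  · rintro x ⟨hi, hj⟩ r ⟨hr, -⟩
    exact ⟨hg1 (ENNReal.ofReal_le_ofReal (by nlinarith)),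
      hg1 (ENNReal.ofReal_le_ofReal (by nlinarith))⟩

/-- Under asymptotic full dependence two normalized components differ, on the scale `t`, with
negligible probability. -/
theorem IsParetoClaims.tendsto_discrepancy (hV : IsParetoClaims P V α K ν) (hα : 0 < α)
    (hK : ∀ j, 0 < K j) (hdep : AsympFullyDependent α K ν) (i j : Fin d) {a b : ℝ}
    (hb : 0 < b) (hab : b < a) :
    Tendsto (fun t : ℝ => t ^ α *
      P.real {ω | a * K i ^ (1 / α) * t ≤ V ω i ∧ V ω j ≤ b * K j ^ (1 / α) * t})
      atTop (𝓝 0) := by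
  -- `g` rises from `0` to `1` between `e` and `a`, `h` falls from `1` to `0` between `c` and `e`;
  -- the gap between `b` and `c` is the room for the dilations
  obtain ⟨c, hbc, hca⟩ := exists_between hab
  obtain ⟨e, hce, hea⟩ := exists_between hca
  have hc : 0 < c := hb.trans hbc
  have he : 0 < e := hc.trans hce
  have ha : 0 < a := he.trans hea
  have hki : 0 < K i ^ (1 / α) := Real.rpow_pos_of_pos (hK i) _
  have hkj : 0 < K j ^ (1 / α) := Real.rpow_pos_of_pos (hK j) _
  set ki := K i ^ (1 / α)
  set kj := K j ^ (1 / α)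
  have hlt : ENNReal.ofReal (e * ki) < ENNReal.ofReal (a * ki) :=
    (ENNReal.ofReal_lt_ofReal_iff (by positivity)).2 (by gcongr)
  have hlt' : ENNReal.ofReal (c * kj) < ENNReal.ofReal (e * kj) :=
    (ENNReal.ofReal_lt_ofReal_iff (by positivity)).2 (by gcongr)
  obtain ⟨g, hg0, hg1, hg01⟩ := exists_continuous_zero_one_of_isClosed
    (isClosed_Iic (a := ENNReal.ofReal (e * ki))) (isClosed_Ici (a := ENNReal.ofReal (a * ki)))
    (Set.disjoint_left.2 fun x hx hx' => absurd (le_trans hx' hx) (not_le.2 hlt))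
  obtain ⟨h, hh0, hh1, hh01⟩ := exists_continuous_zero_one_of_isClosed
    (isClosed_Ici (a := ENNReal.ofReal (e * kj))) (isClosed_Iic (a := ENNReal.ofReal (c * kj)))
    (Set.disjoint_left.2 fun x hx hx' => absurd (le_trans hx hx') (not_le.2 hlt'))
  have hlim := hV.tendsto_negligible hα i j g.continuous h.continuous hg01 hh01
    (ENNReal.ofReal_pos.2 (mul_pos he hki)) (fun x hx => hg0 hx) ?_ ((one_lt_div hb).2 hbc)
    (D := {x | a * ki ≤ x i ∧ x j ≤ b * kj}) ?_
  · refine hlim.congr' ?_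
    filter_upwards [eventually_gt_atTop 0] with t ht
    simp only [Pi.smul_apply, smul_eq_mul, inv_mul_eq_div, le_div_iff₀ ht,
      div_le_iff₀ ht]
  · have : ∀ᵐ x ∂ν, ∃ s : ℝ, 0 < s ∧ ∀ j, x.1 j = ENNReal.ofReal (s * K j ^ (1 / α)) := hdep
    filter_upwards [this] with x ⟨s, hs, hx⟩
    rw [hx i, hx j]
    -- on the ray `g ≠ 0` forces `e < s`, while `h ≠ 0` forces `s < e`
    rcases le_total s e with hse | hse
    · rw [hg0 (x := ENNReal.ofReal (s * ki)) (ENNReal.ofReal_le_ofReal (by gcongr))]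
      simp
    · rw [hh0 (x := ENNReal.ofReal (s * kj)) (ENNReal.ofReal_le_ofReal (by gcongr))]
      simp
  · rintro x ⟨hi, hj⟩ r ⟨hr, hr'⟩
    refine ⟨hg1 (ENNReal.ofReal_le_ofReal ?_), hh1 (ENNReal.ofReal_le_ofReal ?_)⟩
    · have : 0 < a * ki := by positivity
      nlinarith
    · calc r * x j ≤ r * (b * kj) := by gcongr
        _ ≤ c / b * (b * kj) := by gcongr
        _ = c * kj := by field_simp

end Negligible

/-! ### Deterministic weights -/

/-- A squeeze lemma: the bounds are the limit `L` with the threshold rescaled by a factor `c`, and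
`c → 1` from either side. -/
theorem tendsto_of_scaled_bounds {F : ℝ → ℝ} {L α : ℝ}
    (hu : ∀ c : ℝ, 0 < c → c < 1 →
      ∃ u, Tendsto u atTop (𝓝 (L * c ^ (-α))) ∧ ∀ᶠ t in atTop, F t ≤ u t)
    (hl : ∀ c : ℝ, 1 < c →
      ∃ u, Tendsto u atTop (𝓝 (L * c ^ (-α))) ∧ ∀ᶠ t in atTop, u t ≤ F t) :
    Tendsto F atTop (𝓝 L) := by
  have hc : Tendsto (fun c : ℝ => L * c ^ (-α)) (𝓝 1) (𝓝 L) := by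
    have : ContinuousAt (fun c : ℝ => L * c ^ (-α)) 1 :=
      continuousAt_const.mul (Real.continuousAt_rpow_const _ _ (Or.inl one_ne_zero))
    simpa [ContinuousAt] using this
  refine tendsto_order.2 ⟨fun b hb => ?_, fun b hb => ?_⟩
  · obtain ⟨c, hbc, hc1⟩ := (((hc.eventually_const_lt hb).filter_mono
      (nhdsWithin_le_nhds (s := Set.Ioi 1))).and self_mem_nhdsWithin).exists
    obtain ⟨u, hu, hle⟩ := hl c hc1
    filter_upwards [hu.eventually_const_lt hbc, hle] with t h1 h2 using h1.trans_le h2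
  · obtain ⟨c, hbc, hc0, hc1⟩ := (((hc.eventually_lt_const hb).filter_mono
      (nhdsWithin_le_nhds (s := Set.Iio 1))).and
        (Ioo_mem_nhdsLT (show (0 : ℝ) < 1 by norm_num))).exists
    obtain ⟨u, hu, hle⟩ := hu c hc0 hc1
    filter_upwards [hu.eventually_lt_const hbc, hle] with t h1 h2 using h2.trans_lt h1

/-- If a sum is at least `t` while every term is below `c t` with `c < 1`, then two of the terms
are of order `t`. -/
theorem exists_ne_le_of_le_sum {d : ℕ} {z : Fin d → ℝ} {c t : ℝ} (hc : 0 < c) (hc1 : c < 1)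
    (ht : 0 < t) (hsum : t ≤ ∑ j, z j) (hlt : ∀ j, z j < c * t) :
    ∃ i j, i ≠ j ∧ (1 - c) / d * t ≤ z i ∧ (1 - c) / d * t ≤ z j := by
  have hd : 0 < d := by
    rcases Nat.eq_zero_or_pos d with rfl | h
    · simp at hsum; linarith
    · exact h
  have hd' : (0 : ℝ) < d := by exact_mod_cast hd
  have : Nonempty (Fin d) := ⟨⟨0, hd⟩⟩
  obtain ⟨j, -, hj⟩ := Finset.exists_le_of_sum_le (s := Finset.univ) Finset.univ_nonempty
    (f := fun _ => t / d) (g := z) (by simpa [mul_div_cancel₀ _ hd'.ne'] using hsum)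
  have hε : (1 - c) / d * t ≤ t / d := by
    rw [div_mul_eq_mul_div]
    gcongr
    nlinarith
  have hi : ∃ i, i ≠ j ∧ (1 - c) / d * t ≤ z i := by
    by_contra! hcon
    have h1 : ∑ i ∈ Finset.univ.erase j, z i ≤ (d - 1 : ℕ) • ((1 - c) / d * t) := by
      have h2 := Finset.sum_le_card_nsmul (Finset.univ.erase j) z ((1 - c) / d * t)
        fun i hi => (hcon i (Finset.ne_of_mem_erase hi)).le
      simpa [Finset.card_erase_of_mem] using h2
    have h5 : (d - 1 : ℕ) • ((1 - c) / d * t) ≤ (1 - c) * t := by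
      have h6 : ((d - 1 : ℕ) : ℝ) ≤ d := by exact_mod_cast Nat.sub_le d 1
      have h7 : 0 < (1 - c) / d * t := by
        have : 0 < 1 - c := by linarith
        positivity
      calc (d - 1 : ℕ) • ((1 - c) / d * t) ≤ d * ((1 - c) / d * t) := by
            rw [nsmul_eq_mul]; gcongr
        _ = (1 - c) * t := by field_simp
    rw [← Finset.add_sum_erase _ _ (Finset.mem_univ j)] at hsum
    linarith [hlt j]
  obtain ⟨i, hij, hi⟩ := hi
  exact ⟨i, j, hij, hi, hε.trans hj⟩

section

variable {Ω : Type*} [MeasurableSpace Ω] {P : Measure Ω} {d : ℕ}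
  {V : Ω → Fin d → ℝ} {α : ℝ} {K : Fin d → ℝ} {ν : Measure (PuncturedOrthant d)}

theorem IsParetoClaims.tendsto_tail_lt (hV : IsParetoClaims P V α K ν) (hK : ∀ j, 0 < K j)
    (j : Fin d) {c : ℝ} (hc : 0 < c) :
    Tendsto (fun t : ℝ => t ^ α * P.real {ω | c * t < V ω j}) atTop (𝓝 (K j * c ^ (-α))) := by
  have hKj := hK j
  have h1 : Tendsto (fun t : ℝ => t ^ α * P.real {ω | t < V ω j}) atTop (𝓝 (K j)) := by
    have h := (isEquivalent_iff_tendsto_one ?_).1 (hV.pareto j)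
    · have h2 := h.const_mul (K j)
      rw [mul_one] at h2
      refine h2.congr' ?_
      filter_upwards [eventually_gt_atTop 0] with t ht
      have : 0 < t ^ α := Real.rpow_pos_of_pos ht _
      simp only [Pi.div_apply, Real.rpow_neg ht.le]
      field_simp
    · filter_upwards [eventually_gt_atTop 0] with t ht
      exact (mul_pos hKj (Real.rpow_pos_of_pos ht _)).ne'
  have h3 := (h1.comp (tendsto_id.const_mul_atTop hc)).mul_const (c ^ (-α))
  refine h3.congr' ?_
  filter_upwards [eventually_gt_atTop 0] with t ht
  have : 0 < c ^ α := Real.rpow_pos_of_pos hc _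
  simp only [Function.comp_apply, id_eq, Real.mul_rpow hc.le ht.le, Real.rpow_neg hc.le]
  field_simp

variable [IsProbabilityMeasure P]

/-- The second Bonferroni inequality, with every pair counted twice. -/
theorem sum_measureReal_le {A : Fin d → Set Ω} (hA : ∀ j, MeasurableSet (A j)) :
    ∑ j, P.real (A j) ≤
      P.real (⋃ j, A j) + ∑ j, ∑ i ∈ Finset.univ.erase j, P.real (A i ∩ A j) := by
  set C : Fin d → Set Ω := fun j => A j \ ⋃ i ∈ Finset.univ.erase j, A i with hC
  have hCm : ∀ j, MeasurableSet (C j) := fun j =>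
    (hA j).diff (Finset.measurableSet_biUnion _ fun i _ => hA i)
  have hdisj : Pairwise (Function.onFun Disjoint C) := by
    intro i j hij
    refine Set.disjoint_left.2 fun ω hi hj => hj.2 ?_
    exact Set.mem_biUnion (Finset.mem_erase.2 ⟨hij, Finset.mem_univ i⟩) hi.1
  have h1 : ∑ j, P.real (C j) ≤ P.real (⋃ j, A j) := by
    rw [← measureReal_iUnion_fintype hdisj hCm]
    exact measureReal_mono (Set.iUnion_mono fun j => Set.sdiff_subset)
  have h2 : ∀ j, P.real (A j) ≤
      P.real (C j) + ∑ i ∈ Finset.univ.erase j, P.real (A i ∩ A j) := fun j => by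
    have hsub : A j ⊆ C j ∪ ⋃ i ∈ Finset.univ.erase j, A i ∩ A j := by
      intro ω hω
      by_cases h : ω ∈ ⋃ i ∈ Finset.univ.erase j, A i
      · right
        simp only [Set.mem_iUnion] at h ⊢
        obtain ⟨i, hi, h⟩ := h
        exact ⟨i, hi, h, hω⟩
      · exact Or.inl ⟨hω, h⟩
    calc P.real (A j) ≤ _ := measureReal_mono hsub
      _ ≤ _ := measureReal_union_le _ _
      _ ≤ _ := by gcongr; exact measureReal_biUnion_finset_le _ _
  calc ∑ j, P.real (A j) ≤ _ := Finset.sum_le_sum fun j _ => h2 j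
    _ ≤ _ := by rw [Finset.sum_add_distrib]; gcongr

theorem IsParetoClaims.tendsto_tail_le (hV : IsParetoClaims P V α K ν) (hK : ∀ j, 0 < K j)
    (j : Fin d) {c : ℝ} (hc : 0 < c) :
    Tendsto (fun t : ℝ => t ^ α * P.real {ω | c * t ≤ V ω j}) atTop (𝓝 (K j * c ^ (-α))) := by
  have hmul : ∀ r : ℝ, 0 < r → K j * c ^ (-α) * r ^ (-α) = K j * (r * c) ^ (-α) := fun r hr => by
    rw [Real.mul_rpow hr.le hc.le]; ring
  refine tendsto_of_scaled_bounds (α := α) 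
    (fun r hr0 hr1 => ⟨fun t => t ^ α * P.real {ω | r * c * t < V ω j}, ?_, ?_⟩)
    fun r hr => ⟨fun t => t ^ α * P.real {ω | r * c * t < V ω j}, ?_, ?_⟩
  · rw [hmul r hr0]
    exact hV.tendsto_tail_lt hK j (mul_pos hr0 hc)
  · filter_upwards [eventually_gt_atTop 0] with t ht
    refine mul_le_mul_of_nonneg_left (measureReal_mono fun ω (hω : c * t ≤ V ω j) => ?_)
      (by positivity)
    have : 0 < c * t := by positivity
    exact show r * c * t < V ω j from lt_of_lt_of_le (by nlinarith) hω
  · rw [hmul r (by linarith)]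
    exact hV.tendsto_tail_lt hK j (mul_pos (by linarith) hc)
  · filter_upwards [eventually_gt_atTop 0] with t ht
    refine mul_le_mul_of_nonneg_left (measureReal_mono fun ω (hω : r * c * t < V ω j) => ?_)
      (by positivity)
    have : 0 < c * t := by positivity
    exact show c * t ≤ V ω j from le_trans (by nlinarith) hω.le

theorem IsParetoClaims.tendsto_tail_mul (hV : IsParetoClaims P V α K ν) (hα : 0 < α)
    (hK : ∀ j, 0 < K j) (j : Fin d) {c y : ℝ} (hc : 0 < c) (hy : 0 ≤ y) :
    Tendsto (fun t : ℝ => t ^ α * P.real {ω | c * t ≤ y * V ω j}) atTop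
      (𝓝 (K j * y ^ α * c ^ (-α))) := by
  rcases hy.eq_or_lt with rfl | hy
  · rw [Real.zero_rpow hα.ne', mul_zero, zero_mul]
    refine tendsto_const_nhds.congr' ?_
    filter_upwards [eventually_gt_atTop 0] with t ht
    have : {ω | c * t ≤ 0 * V ω j} = ∅ := by
      refine Set.eq_empty_of_forall_notMem fun ω hω => ?_
      rw [Set.mem_ofPred_eq, zero_mul] at hω
      exact absurd hω (not_le.2 (by positivity))
    rw [this, measureReal_empty, mul_zero]
  · have h := hV.tendsto_tail_le hK j (div_pos hc hy)
    rw [Real.div_rpow hc.le hy.le, Real.rpow_neg hy.le, div_inv_eq_mul] at h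
    convert h using 2
    · congr! 4 with ω
      rw [div_mul_eq_mul_div, div_le_iff₀ hy, mul_comm y]
    · ring

/-- For a fixed weight vector the asymptotically independent claims contribute their tails
separately: the sum is large because exactly one term is. -/
theorem IsParetoClaims.tendsto_tail_sum_of_asympIndependent (hV : IsParetoClaims P V α K ν)
    (hα : 0 < α) (hK : ∀ j, 0 < K j) (hind : AsympIndependent ν) {y : Fin d → ℝ}
    (hy : ∀ j, 0 ≤ y j) :
    Tendsto (fun t : ℝ => t ^ α * P.real {ω | t ≤ ∑ j, y j * V ω j}) atTop
      (𝓝 (∑ j, K j * y j ^ α)) := by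
  have hy0 : 0 ≤ ∑ j, y j := Finset.sum_nonneg fun j _ => hy j
  set M := 1 + ∑ j, y j with hM
  have hM0 : 0 < M := by linarith
  have hyM : ∀ j, y j ≤ M := fun j => by
    have := Finset.single_le_sum (fun i _ => hy i) (Finset.mem_univ j)
    linarith
  -- a large weighted term comes from a large component, as the weights are at most `M`
  have hmem : ∀ {ω : Ω} {j : Fin d} {r t : ℝ}, 0 < r → 0 < t → r * t ≤ y j * V ω j →
      r / M * t ≤ V ω j := fun {ω j r t} hr ht h => by
    have h1 : 0 < y j * V ω j := lt_of_lt_of_le (by positivity) h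
    have h2 : 0 < V ω j := pos_of_mul_pos_right h1 (hy j)
    rw [div_mul_eq_mul_div, div_le_iff₀ hM0, mul_comm _ M]
    exact h.trans (mul_le_mul_of_nonneg_right (hyM j) h2.le)
  have hpair : ∀ {δ : ℝ}, 0 < δ → Tendsto (fun t : ℝ => ∑ j, ∑ i ∈ Finset.univ.erase j,
      t ^ α * P.real {ω | δ * t ≤ V ω i ∧ δ * t ≤ V ω j}) atTop (𝓝 0) := fun {δ} hδ => by
    have h := tendsto_finsetSum Finset.univ fun j _ =>
      tendsto_finsetSum (Finset.univ.erase j) fun i hi =>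
        hV.tendsto_joint_exceedance hα hind (Finset.ne_of_mem_erase hi) hδ
    simpa using h
  have hsing : ∀ {c : ℝ}, 0 < c → Tendsto (fun t : ℝ => ∑ j,
      t ^ α * P.real {ω | c * t ≤ y j * V ω j}) atTop
      (𝓝 ((∑ j, K j * y j ^ α) * c ^ (-α))) := fun {c} hc => by
    rw [Finset.sum_mul]
    exact tendsto_finsetSum Finset.univ fun j _ => hV.tendsto_tail_mul hα hK j hc (hy j)
  refine tendsto_of_scaled_bounds (α := α) (fun c hc0 hc1 => ?_) fun c hc => ?_
  · rcases Nat.eq_zero_or_pos d with rfl | hd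
    · refine ⟨_, hsing hc0, ?_⟩
      filter_upwards [eventually_gt_atTop 0] with t ht
      simp [not_le.2 ht]
    have hd' : (0 : ℝ) < d := by exact_mod_cast hd
    have hε : 0 < (1 - c) / d := div_pos (by linarith) hd'
    have hlim := (hsing hc0).add (hpair (div_pos hε hM0))
    rw [add_zero] at hlim
    refine ⟨_, hlim, ?_⟩
    filter_upwards [eventually_gt_atTop 0] with t ht
    simp only [← Finset.mul_sum, ← mul_add]
    refine mul_le_mul_of_nonneg_left ?_ (by positivity)
    have hsub : {ω | t ≤ ∑ j, y j * V ω j} ⊆ (⋃ j, {ω | c * t ≤ y j * V ω j}) ∪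
        ⋃ j, ⋃ i ∈ Finset.univ.erase j,
          {ω | (1 - c) / d / M * t ≤ V ω i ∧ (1 - c) / d / M * t ≤ V ω j} := by
      intro ω hω
      by_cases h : ∃ j, c * t ≤ y j * V ω j
      · exact Or.inl (Set.mem_iUnion.2 h)
      · push Not at h
        obtain ⟨i, j, hij, hi, hj⟩ := exists_ne_le_of_le_sum hc0 hc1 ht hω h
        refine Or.inr (Set.mem_iUnion.2 ⟨j, Set.mem_biUnion (x := i) ?_ ⟨?_, ?_⟩⟩)
        · exact Finset.mem_erase.2 ⟨hij, Finset.mem_univ i⟩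
        · exact hmem hε ht hi
        · exact hmem hε ht hj
    refine (measureReal_mono hsub).trans ((measureReal_union_le _ _).trans (add_le_add ?_ ?_))
    · exact measureReal_iUnion_fintype_le _
    · exact (measureReal_iUnion_fintype_le _).trans
        (Finset.sum_le_sum fun j _ => measureReal_biUnion_finset_le _ _)
  · have hc0 : 0 < c := by linarith
    have hlim := (hsing hc0).sub (hpair (div_pos hc0 hM0))
    rw [sub_zero] at hlim
    refine ⟨_, hlim, ?_⟩
    filter_upwards [eventually_gt_atTop 0] with t ht
    simp only [← Finset.mul_sum, ← mul_sub]
    refine mul_le_mul_of_nonneg_left ?_ (by positivity)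
    have hVj : ∀ j, Measurable fun ω => V ω j := fun j =>
      (measurable_pi_apply j).comp hV.measurable
    have hB := sum_measureReal_le (P := P) (A := fun j => {ω | c * t ≤ y j * V ω j})
      fun j => measurableSet_le measurable_const ((hVj j).const_mul _)
    have hU : P.real (⋃ j, {ω | c * t ≤ y j * V ω j}) ≤ P.real {ω | t ≤ ∑ j, y j * V ω j} := by
      refine ENNReal.toReal_mono (measure_ne_top _ _) (measure_mono_ae ?_)
      filter_upwards [hV.nonneg] with ω hω hmemU
      obtain ⟨j, hj⟩ := Set.mem_iUnion.1 hmemU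
      have h1 := Finset.single_le_sum (f := fun i => y i * V ω i)
        (fun i _ => mul_nonneg (hy i) (hω i)) (Finset.mem_univ j)
      have h2 : c * t ≤ y j * V ω j := hj
      exact le_trans (by nlinarith) (h2.trans h1)
    have hP : ∑ j, ∑ i ∈ Finset.univ.erase j,
        P.real ({ω | c * t ≤ y i * V ω i} ∩ {ω | c * t ≤ y j * V ω j}) ≤
        ∑ j, ∑ i ∈ Finset.univ.erase j, P.real {ω | c / M * t ≤ V ω i ∧ c / M * t ≤ V ω j} :=
      Finset.sum_le_sum fun j _ => Finset.sum_le_sum fun i _ =>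
        measureReal_mono fun ω hω => ⟨hmem hc0 ht hω.1, hmem hc0 ht hω.2⟩
    linarith

/-- For a fixed weight vector the asymptotically fully dependent claims behave, on the scale `t`,
like multiples of a single one of them. -/
theorem IsParetoClaims.tendsto_tail_sum_of_asympFullyDependent (hV : IsParetoClaims P V α K ν)
    (hα : 0 < α) (hK : ∀ j, 0 < K j) (hdep : AsympFullyDependent α K ν) {y : Fin d → ℝ}
    (hy : ∀ j, 0 ≤ y j) :
    Tendsto (fun t : ℝ => t ^ α * P.real {ω | t ≤ ∑ j, y j * V ω j}) atTop
      (𝓝 ((∑ j, K j ^ (1 / α) * y j) ^ α)) := by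
  have hk : ∀ j, 0 < K j ^ (1 / α) := fun j => Real.rpow_pos_of_pos (hK j) _
  have hkα : ∀ j, (K j ^ (1 / α)) ^ α = K j := fun j => by
    rw [← Real.rpow_mul (hK j).le, one_div_mul_cancel hα.ne', Real.rpow_one]
  set k : Fin d → ℝ := fun j => K j ^ (1 / α) with hkdef
  change ∀ j, 0 < k j at hk
  change ∀ j, k j ^ α = K j at hkα
  set S := ∑ j, k j * y j with hS
  change Tendsto _ _ (𝓝 (S ^ α))
  have hS0 : 0 ≤ S := Finset.sum_nonneg fun j _ => mul_nonneg (hk j).le (hy j)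
  rcases hS0.eq_or_lt with h0 | hSpos
  · have hyz : ∀ j, y j = 0 := fun j => by
      have h1 := (Finset.sum_eq_zero_iff_of_nonneg
        (fun j _ => mul_nonneg (hk j).le (hy j))).1 h0.symm j (Finset.mem_univ j)
      exact (mul_eq_zero.1 h1).resolve_left (hk j).ne'
    rw [← h0, Real.zero_rpow hα.ne']
    refine tendsto_const_nhds.congr' ?_
    filter_upwards [eventually_gt_atTop 0] with t ht
    simp [hyz, not_le.2 ht]
  -- the component `l` serves as the reference; its weight makes the strict inequality below strict
  obtain ⟨l, hl⟩ : ∃ l, 0 < y l := by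
    by_contra! hcon
    have : S ≤ 0 := Finset.sum_nonpos fun j _ =>
      mul_nonpos_of_nonneg_of_nonpos (hk j).le (hcon j)
    linarith
  have hmain : ∀ {c : ℝ}, 0 < c → Tendsto (fun t : ℝ => t ^ α *
      P.real {ω | c / S * k l * t ≤ V ω l}) atTop (𝓝 (S ^ α * c ^ (-α))) := fun {c} hc => by
    have h := hV.tendsto_tail_le hK l (mul_pos (div_pos hc hSpos) (hk l))
    have hkl := Real.rpow_pos_of_pos (hk l) α
    rw [Real.mul_rpow (by positivity) (hk l).le, Real.div_rpow hc.le hS0, ← hkα l,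
      Real.rpow_neg hS0, Real.rpow_neg (hk l).le] at h
    convert h using 2
    field_simp
  refine tendsto_of_scaled_bounds (α := α) (fun c hc0 hc1 => ?_) fun c hc => ?_
  · have hlim := (hmain hc0).add (tendsto_finsetSum Finset.univ fun i _ =>
      hV.tendsto_discrepancy hα hK hdep i l (div_pos hc0 hSpos)
        (div_lt_div_of_pos_right hc1 hSpos))
    rw [Finset.sum_const_zero, add_zero] at hlim
    refine ⟨_, hlim, ?_⟩
    filter_upwards [eventually_gt_atTop 0] with t ht
    simp only [← Finset.mul_sum, ← mul_add]
    refine mul_le_mul_of_nonneg_left ?_ (by positivity)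
    have hsub : {ω | t ≤ ∑ j, y j * V ω j} ⊆ {ω | c / S * k l * t ≤ V ω l} ∪
        ⋃ i, {ω | 1 / S * k i * t ≤ V ω i ∧ V ω l ≤ c / S * k l * t} := by
      intro ω (hω : t ≤ _)
      rcases le_total (c / S * k l * t) (V ω l) with h | h
      · exact Or.inl h
      refine Or.inr (Set.mem_iUnion.2 ?_)
      by_contra! hcon
      have hlt : ∀ i, V ω i < 1 / S * k i * t := fun i => by
        by_contra! h'
        exact hcon i ⟨h', h⟩
      have : ∑ j, y j * V ω j < ∑ j, y j * (1 / S * k j * t) :=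
        Finset.sum_lt_sum (fun j _ => mul_le_mul_of_nonneg_left (hlt j).le (hy j))
          ⟨l, Finset.mem_univ l, mul_lt_mul_of_pos_left (hlt l) hl⟩
      have heq : ∑ j, y j * (1 / S * k j * t) = t := by
        calc ∑ j, y j * (1 / S * k j * t) = (∑ j, k j * y j) * (t / S) := by
              rw [Finset.sum_mul]; exact Finset.sum_congr rfl fun j _ => by ring
          _ = t := by rw [← hS]; field_simp
      linarith
    refine (measureReal_mono hsub).trans ((measureReal_union_le _ _).trans ?_)
    exact add_le_add le_rfl (measureReal_iUnion_fintype_le _)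
  · have hc0 : 0 < c := by linarith
    have hlim := (hmain hc0).sub (tendsto_finsetSum Finset.univ fun i _ =>
      hV.tendsto_discrepancy hα hK hdep l i (div_pos one_pos hSpos)
        (div_lt_div_of_pos_right hc hSpos))
    rw [Finset.sum_const_zero, sub_zero] at hlim
    refine ⟨_, hlim, ?_⟩
    filter_upwards [eventually_gt_atTop 0] with t ht
    simp only [← Finset.mul_sum, ← mul_sub]
    refine mul_le_mul_of_nonneg_left (sub_le_iff_le_add.2 ?_) (by positivity)
    have hsub : {ω | c / S * k l * t ≤ V ω l} ⊆ {ω | t ≤ ∑ j, y j * V ω j} ∪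
        ⋃ i, {ω | c / S * k l * t ≤ V ω l ∧ V ω i ≤ 1 / S * k i * t} := by
      intro ω hω
      by_cases h : ∃ i, V ω i ≤ 1 / S * k i * t
      · obtain ⟨i, hi⟩ := h
        exact Or.inr (Set.mem_iUnion.2 ⟨i, hω, hi⟩)
      · push Not at h
        left
        have heq : ∑ j, y j * (1 / S * k j * t) = t := by
          calc ∑ j, y j * (1 / S * k j * t) = (∑ j, k j * y j) * (t / S) := by
                rw [Finset.sum_mul]; exact Finset.sum_congr rfl fun j _ => by ring
            _ = t := by rw [← hS]; field_simp
        calc t = ∑ j, y j * (1 / S * k j * t) := heq.symm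
          _ ≤ ∑ j, y j * V ω j :=
            Finset.sum_le_sum fun j _ => mul_le_mul_of_nonneg_left (h j).le (hy j)
    refine (measureReal_mono hsub).trans ((measureReal_union_le _ _).trans ?_)
    exact add_le_add le_rfl (measureReal_iUnion_fintype_le _)

end

/-! ### Random weights -/

section

variable {Ω : Type*} [MeasurableSpace Ω] {P : Measure Ω} {d : ℕ}
  {V Y : Ω → Fin d → ℝ} {α : ℝ} {K : Fin d → ℝ} {ν : Measure (PuncturedOrthant d)}

theorem measurableSet_le_sum_mul (t : ℝ) :
    MeasurableSet {z : (Fin d → ℝ) × (Fin d → ℝ) | t ≤ ∑ j, z.1 j * z.2 j} :=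
  measurableSet_le measurable_const (by fun_prop)

theorem measure_le_sum_mul (hVm : Measurable V) (t : ℝ) (y : Fin d → ℝ) :
    P {ω | t ≤ ∑ j, y j * V ω j} =
      P.map V (Prod.mk y ⁻¹' {z : (Fin d → ℝ) × (Fin d → ℝ) | t ≤ ∑ j, z.1 j * z.2 j}) := by
  rw [Measure.map_apply hVm (measurable_prodMk_left (measurableSet_le_sum_mul t))]
  rfl

variable [IsProbabilityMeasure P]

theorem measurable_measure_le_sum_mul (hVm : Measurable V) (t : ℝ) :
    Measurable fun y : Fin d → ℝ => P {ω | t ≤ ∑ j, y j * V ω j} := by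
  simp only [measure_le_sum_mul hVm]
  exact measurable_measure_prodMk_left (measurableSet_le_sum_mul t)

/-- Conditioning on the random weights: by independence the claims keep their law. -/
theorem measureReal_le_sum_mul_eq_integral (hVm : Measurable V) (hYm : Measurable Y)
    (hYV : IndepFun Y V P) (t : ℝ) :
    P.real {ω | t ≤ ∑ j, Y ω j * V ω j} =
      ∫ ω, P.real {ω' | t ≤ ∑ j, Y ω j * V ω' j} ∂P := by
  have hm := measurable_measure_le_sum_mul (P := P) hVm t
  simp only [measureReal_def]
  rw [integral_toReal (f := fun ω => P {ω' | t ≤ ∑ j, Y ω j * V ω' j})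
    (hm.comp hYm).aemeasurable (ae_of_all _ fun ω => measure_lt_top _ _)]
  congr 1
  have := Measure.isProbabilityMeasure_map (μ := P) hVm.aemeasurable
  calc P {ω | t ≤ ∑ j, Y ω j * V ω j}
      = P.map (fun ω => (Y ω, V ω)) {z | t ≤ ∑ j, z.1 j * z.2 j} := by
        rw [Measure.map_apply (hYm.prodMk hVm) (measurableSet_le_sum_mul t)]
        rfl
    _ = _ := by
        rw [(indepFun_iff_map_prod_eq_prod_map_map hYm.aemeasurable hVm.aemeasurable).1 hYV,
          Measure.prod_apply (measurableSet_le_sum_mul t)]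
        simp only [← measure_le_sum_mul hVm]
        rw [lintegral_map hm hYm]

/-- Tail bound, uniform over weights in `[0, 1]`. -/
theorem IsParetoClaims.measureReal_le_sum_mul_le (hV : IsParetoClaims P V α K ν) {y : Fin d → ℝ}
    (hy : ∀ j, y j ∈ Set.Icc (0 : ℝ) 1) (t : ℝ) :
    P.real {ω | t ≤ ∑ j, y j * V ω j} ≤ P.real {ω | t ≤ ∑ j, 1 * V ω j} := by
  refine ENNReal.toReal_mono (measure_ne_top _ _) (measure_mono_ae ?_)
  filter_upwards [hV.nonneg] with ω hω h
  exact le_trans (show t ≤ ∑ j, y j * V ω j from h)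
    (Finset.sum_le_sum fun j _ => mul_le_mul_of_nonneg_right (hy j).2 (hω j))

/-- Tail asymptotics for deterministic weights carry over to independent random weights in `[0, 1]`,
by dominated convergence.  If the constant vanishes, then so do the weights. -/
theorem IsParetoClaims.isEquivalent_tail_of_forall (hV : IsParetoClaims P V α K ν)
    (hYm : Measurable Y) (hY : ∀ᵐ ω ∂P, ∀ j, Y ω j ∈ Set.Icc (0 : ℝ) 1) (hYV : IndepFun Y V P)
    {c : (Fin d → ℝ) → ℝ} (hcm : Measurable c)
    (hc0 : ∀ y : Fin d → ℝ, (∀ j, 0 ≤ y j) → c y = 0 → y = 0)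
    (hc : ∀ y : Fin d → ℝ, (∀ j, 0 ≤ y j) →
      Tendsto (fun t : ℝ => t ^ α * P.real {ω | t ≤ ∑ j, y j * V ω j}) atTop (𝓝 (c y))) :
    (fun t : ℝ => P.real {ω | t ≤ ∑ j, Y ω j * V ω j}) ~[atTop]
      fun t => (∫ ω, c (Y ω) ∂P) * t ^ (-α) := by
  have hVm := hV.measurable
  have hc1 := hc (fun _ => 1) fun _ => zero_le_one
  have hcnn : ∀ y : Fin d → ℝ, (∀ j, 0 ≤ y j) → 0 ≤ c y := fun y hy =>
    ge_of_tendsto (hc y hy) (by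
      filter_upwards [eventually_ge_atTop 0] with t ht
      positivity)
  have hcle : ∀ y : Fin d → ℝ, (∀ j, y j ∈ Set.Icc (0 : ℝ) 1) → c y ≤ c fun _ => 1 :=
    fun y hy => le_of_tendsto_of_tendsto (hc y fun j => (hy j).1) hc1 (by
      filter_upwards [eventually_ge_atTop 0] with t ht
      exact mul_le_mul_of_nonneg_left (hV.measureReal_le_sum_mul_le hy t) (by positivity))
  have hlim : Tendsto (fun t : ℝ => t ^ α * P.real {ω | t ≤ ∑ j, Y ω j * V ω j}) atTop
      (𝓝 (∫ ω, c (Y ω) ∂P)) := by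
    simp only [measureReal_le_sum_mul_eq_integral hVm hYm hYV, ← integral_const_mul]
    refine tendsto_integral_filter_of_dominated_convergence (fun _ => c (fun _ => 1) + 1)
      (Eventually.of_forall fun t => ?_) ?_ (integrable_const _) ?_
    · exact (((measurable_measure_le_sum_mul hVm t).comp hYm).ennreal_toReal.const_mul
        _).aestronglyMeasurable
    · filter_upwards [hc1.eventually_le_const (lt_add_one _), eventually_ge_atTop 0] with t ht ht0
      filter_upwards [hY] with ω hω
      rw [Real.norm_of_nonneg (by positivity)]
      exact (mul_le_mul_of_nonneg_left (hV.measureReal_le_sum_mul_le hω t)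
        (by positivity)).trans ht
    · filter_upwards [hY] with ω hω
      exact hc _ fun j => (hω j).1
  set B := ∫ ω, c (Y ω) ∂P with hB
  by_cases hB0 : B = 0
  -- if `B = 0`, then `Y = 0` almost surely and the tail vanishes for every `t > 0`
  · have hint : Integrable (fun ω => c (Y ω)) P := by
      refine Integrable.of_bound (hcm.comp hYm).aestronglyMeasurable (c fun _ => 1) ?_
      filter_upwards [hY] with ω hω
      rw [Real.norm_of_nonneg (hcnn _ fun j => (hω j).1)]
      exact hcle _ hω
    have hnn : 0 ≤ᵐ[P] fun ω => c (Y ω) := by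
      filter_upwards [hY] with ω hω
      exact hcnn _ fun j => (hω j).1
    have hae := (integral_eq_zero_iff_of_nonneg_ae hnn hint).1 hB0
    simp only [hB0, zero_mul]
    refine isEquivalent_zero_iff_eventually_zero.2 ?_
    filter_upwards [eventually_gt_atTop 0] with t ht
    rw [Pi.zero_apply, measureReal_eq_zero_iff]
    have hnot : ∀ᵐ ω ∂P, ¬ t ≤ ∑ j, Y ω j * V ω j := by
      filter_upwards [hY, hae] with ω hω h0
      simp [hc0 _ (fun j => (hω j).1) h0, ht]
    exact measure_eq_zero_iff_ae_notMem.2 hnot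
  · refine isEquivalent_of_tendsto_one ?_
    have h := hlim.div_const B
    rw [div_self hB0] at h
    refine h.congr' ?_
    filter_upwards [eventually_gt_atTop 0] with t ht
    have : 0 < t ^ α := Real.rpow_pos_of_pos ht _
    simp only [Pi.div_apply, Real.rpow_neg ht.le]
    field_simp

variable {q : ℕ}

theorem measurable_uninsuredShare {A : Ω → Fin q → Fin d → ℝ} (hA : Measurable A) :
    Measurable (uninsuredShare A) := by
  unfold uninsuredShare
  fun_prop

/-- The tail of the uninsured loss, for any market matrix that is independent of the claims and
insures between none and all of each object. -/
theorem IsParetoClaims.uninsuredTail (hV : IsParetoClaims P V α K ν) (hα : 0 < α)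
    (hK : ∀ j, 0 < K j) {A : Ω → Fin q → Fin d → ℝ} (hA : Measurable A)
    (hshare : ∀ᵐ ω ∂P, ∀ j, uninsuredShare A ω j ∈ Set.Icc (0 : ℝ) 1) (hAV : IndepFun A V P) :
    (AsympIndependent ν → UninsuredTail P A V α (Bind P α K A)) ∧
      (AsympFullyDependent α K ν → UninsuredTail P A V α (Bdep P α K A)) := by
  have hm := measurable_uninsuredShare hA
  have hYV : IndepFun (uninsuredShare A) V P :=
    hAV.comp (φ := fun (a : Fin q → Fin d → ℝ) j => 1 - ∑ i, a i j) (ψ := id)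
      (by fun_prop) measurable_id
  refine ⟨fun hind => ?_, fun hdep => ?_⟩
  · have hBind : Bind P α K A = ∫ ω, ∑ j, K j * uninsuredShare A ω j ^ α ∂P := by
      rw [integral_finsetSum]
      · simp only [integral_const_mul, Bind]
      · intro j _
        refine Integrable.const_mul (Integrable.of_bound (C := 1) ?_ ?_) _
        · exact (((measurable_pi_apply j).comp hm).pow_const α).aestronglyMeasurable
        · filter_upwards [hshare] with ω hω
          rw [Real.norm_of_nonneg (Real.rpow_nonneg (hω j).1 _)]
          exact Real.rpow_le_one (hω j).1 (hω j).2 hα.le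
    rw [hBind]
    refine hV.isEquivalent_tail_of_forall hm hshare hYV (c := fun y => ∑ j, K j * y j ^ α)
      (by fun_prop) (fun y hy h0 => ?_)
      fun y hy => hV.tendsto_tail_sum_of_asympIndependent hα hK hind hy
    ext j
    have h1 := (Finset.sum_eq_zero_iff_of_nonneg fun j _ =>
      mul_nonneg (hK j).le (Real.rpow_nonneg (hy j) α)).1 h0 j (Finset.mem_univ j)
    exact (Real.rpow_eq_zero (hy j) hα.ne').1 ((mul_eq_zero.1 h1).resolve_left (hK j).ne')
  · refine hV.isEquivalent_tail_of_forall hm hshare hYV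
      (c := fun y => (∑ j, K j ^ (1 / α) * y j) ^ α)
      (by fun_prop) (fun y hy h0 => ?_)
      fun y hy => hV.tendsto_tail_sum_of_asympFullyDependent hα hK hdep hy
    have hk : ∀ j, 0 < K j ^ (1 / α) := fun j => Real.rpow_pos_of_pos (hK j) _
    have hnn : ∀ j ∈ Finset.univ, 0 ≤ K j ^ (1 / α) * y j := fun j _ =>
      mul_nonneg (hk j).le (hy j)
    ext j
    have h1 := (Finset.sum_eq_zero_iff_of_nonneg hnn).1
      ((Real.rpow_eq_zero (Finset.sum_nonneg hnn) hα.ne').1 h0) j (Finset.mem_univ j)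
    exact (mul_eq_zero.1 h1).resolve_left (hk j).ne'

end

/-! ### The random graph -/

section

variable {Ω : Type*} [MeasurableSpace Ω] {P : Measure Ω} {q d : ℕ} {α : ℝ} {K : Fin d → ℝ}
  {p : Fin q → Fin d → ℝ} {E : Fin q → Fin d → Set Ω}


theorem edge_nonneg {Ω : Type*} {q d : ℕ} (E : Fin q → Fin d → Set Ω) (ω : Ω) (i : Fin q)
    (j : Fin d) :
    0 ≤ edge E ω i j :=
  Set.indicator_nonneg (fun _ _ => zero_le_one) _

theorem edge_le_one {Ω : Type*} {q d : ℕ} (E : Fin q → Fin d → Set Ω) (ω : Ω) (i : Fin q)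
    (j : Fin d) :
    edge E ω i j ≤ 1 :=
  Set.indicator_le_self' (fun _ _ => zero_le_one) _

theorem measurable_edge (hE : ∀ i j, MeasurableSet (E i j)) : Measurable (edge E) :=
  measurable_pi_lambda _ fun i => measurable_pi_lambda _ fun j =>
    measurable_const.indicator (hE i j)

theorem measurable_marketMatrix (hE : ∀ i j, MeasurableSet (E i j)) {W : Ω → Fin q → Fin d → ℝ}
    (hW : Measurable W) : Measurable (marketMatrix E W) := by
  have := measurable_edge hE
  unfold marketMatrix
  fun_prop

theorem uninsuredShare_marketMatrix_mem_Icc {Ω : Type*} {q d : ℕ}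
    {E : Fin q → Fin d → Set Ω} {W : Ω → Fin q → Fin d → ℝ} {ω : Ω} {j : Fin d}
    (h0 : ∀ i, 0 ≤ W ω i j) (h1 : ∑ i, W ω i j ≤ 1) :
    uninsuredShare (marketMatrix E W) ω j ∈ Set.Icc (0 : ℝ) 1 := by
  have hle : ∑ i, marketMatrix E W ω i j ≤ ∑ i, W ω i j := Finset.sum_le_sum fun i _ =>
    mul_le_of_le_one_left (h0 i) (edge_le_one E ω i j)
  have hnn : 0 ≤ ∑ i, marketMatrix E W ω i j := Finset.sum_nonneg fun i _ =>
    mul_nonneg (edge_nonneg E ω i j) (h0 i)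
  unfold uninsuredShare
  constructor <;> linarith

/-- The event that no agent insures object `j`. -/
def isolated {Ω : Type*} {q d : ℕ} (E : Fin q → Fin d → Set Ω) (j : Fin d) : Set Ω := ⋂ i, (E i j)ᶜ

/-- Under equal splitting an object is insured completely unless it is isolated. -/
theorem uninsuredShare_equalSplit {Ω : Type*} {q d : ℕ} (E : Fin q → Fin d → Set Ω) (ω : Ω)
    (j : Fin d) :
    uninsuredShare (equalSplit E) ω j = (isolated E j).indicator 1 ω := by
  have hsum : ∑ i, equalSplit E ω i j = deg E ω j / deg E ω j := by
    simp only [equalSplit, ← Finset.sum_div]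
    rfl
  have hdeg : deg E ω j = 0 ↔ ω ∈ isolated E j := by
    rw [deg, Finset.sum_eq_zero_iff_of_nonneg fun i _ => edge_nonneg E ω i j]
    simp [isolated, edge]
  rw [uninsuredShare, hsum]
  by_cases h : ω ∈ isolated E j
  · simp [h, hdeg.2 h]
  · simp [h, div_self (mt hdeg.1 h)]

theorem IsRandomBipartiteGraph.measurableSet_isolated (hE : IsRandomBipartiteGraph P p E)
    (j : Fin d) : MeasurableSet (isolated E j) :=
  MeasurableSet.iInter fun i => (hE.measurableSet i j).compl

theorem IsRandomBipartiteGraph.measure_biInter_isolated (hE : IsRandomBipartiteGraph P p E)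
    (s : Finset (Fin d)) : P (⋂ j ∈ s, isolated E j) = ∏ j ∈ s, ∏ i, P (E i j)ᶜ := by
  -- independence of the complements, from that of the indicators
  have hind := (hE.indep.iIndepFun_indicator (β := ℝ)).measure_inter_preimage_eq_mul
    (s ×ˢ Finset.univ |>.map (Equiv.prodComm _ _).toEmbedding) (sets := fun _ => {0})
    fun _ _ => measurableSet_singleton 0
  have hpre : ∀ ij : Fin q × Fin d, (E ij.1 ij.2).indicator (fun _ => (1 : ℝ)) ⁻¹' {0} =
      (E ij.1 ij.2)ᶜ := fun ij => by
    ext ω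
    simp
  simp only [hpre, Finset.prod_map, Finset.prod_product] at hind
  rw [← show _ = ∏ j ∈ s, ∏ i, P (E i j)ᶜ from hind]
  congr 1
  ext ω
  simp only [isolated, Set.mem_iInter, Finset.mem_map, Finset.mem_product]
  constructor
  · rintro h _ ⟨⟨j, i⟩, ⟨hj, -⟩, rfl⟩
    exact h j hj i
  · intro h j hj i
    exact h (i, j) ⟨(j, i), ⟨hj, Finset.mem_univ i⟩, rfl⟩

theorem IsRandomBipartiteGraph.measure_isolated (hE : IsRandomBipartiteGraph P p E)
    (j : Fin d) : P (isolated E j) = ∏ i, P (E i j)ᶜ := by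
  simpa using hE.measure_biInter_isolated {j}

theorem IsRandomBipartiteGraph.iIndepSet_isolated (hE : IsRandomBipartiteGraph P p E) :
    iIndepSet (isolated E) P := by
  rw [iIndepSet_iff_meas_biInter hE.measurableSet_isolated]
  intro s
  simp only [hE.measure_biInter_isolated, hE.measure_isolated]

variable [IsProbabilityMeasure P]

theorem IsRandomBipartiteGraph.measureReal_isolated (hE : IsRandomBipartiteGraph P p E)
    (j : Fin d) : P.real (isolated E j) = ∏ i, (1 - p i j) := by
  rw [measureReal_def, hE.measure_isolated, ENNReal.toReal_prod]
  refine Finset.prod_congr rfl fun i _ => ?_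
  rw [← measureReal_def, probReal_compl_eq_one_sub (hE.measurableSet i j), hE.prob]

theorem IsRandomBipartiteGraph.bind_equalSplit (hE : IsRandomBipartiteGraph P p E) (hα : 0 < α) :
    Bind P α K (equalSplit E) = ∑ j, K j * ∏ i, (1 - p i j) := by
  refine Finset.sum_congr rfl fun j _ => ?_
  have h : ∀ ω, uninsuredShare (equalSplit E) ω j ^ α = (isolated E j).indicator 1 ω := fun ω => by
    rw [uninsuredShare_equalSplit]
    by_cases h : ω ∈ isolated E j <;> simp [h, Real.zero_rpow hα.ne']
  simp only [h]
  rw [integral_indicator_one (hE.measurableSet_isolated j), hE.measureReal_isolated]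

/-- The law of the pattern of isolated objects. -/
theorem IsRandomBipartiteGraph.measureReal_pattern (hE : IsRandomBipartiteGraph P p E)
    (n : Fin d → Fin 2) :
    P.real ((fun ω j => (isolated E j).indicator (fun _ => (1 : Fin 2)) ω) ⁻¹' {n}) =
      ∏ j, (∏ i, (1 - p i j)) ^ (n j : ℕ) * (1 - ∏ i, (1 - p i j)) ^ (1 - (n j : ℕ)) := by
  have hind := (hE.iIndepSet_isolated.iIndepFun_indicator
    (β := Fin 2)).measure_inter_preimage_eq_mul Finset.univ (sets := fun j => {n j})
    fun _ _ => measurableSet_singleton _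
  have hset : (fun ω j => (isolated E j).indicator (fun _ => (1 : Fin 2)) ω) ⁻¹' {n} =
      ⋂ j ∈ Finset.univ, (isolated E j).indicator (fun _ => (1 : Fin 2)) ⁻¹' {n j} := by
    ext ω
    simp [funext_iff]
  rw [hset, measureReal_def, hind, ENNReal.toReal_prod]
  refine Finset.prod_congr rfl fun j _ => ?_
  rw [← measureReal_def, ← hE.measureReal_isolated]
  generalize n j = m
  fin_cases m
  · have : (isolated E j).indicator (fun _ => (1 : Fin 2)) ⁻¹' {0} = (isolated E j)ᶜ := by
      ext ω
      simp
    simp [this, probReal_compl_eq_one_sub (hE.measurableSet_isolated j)]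
  · have : (isolated E j).indicator (fun _ => (1 : Fin 2)) ⁻¹' {1} = isolated E j := by
      ext ω
      simp
    simp [this]

theorem IsRandomBipartiteGraph.bdep_equalSplit (hE : IsRandomBipartiteGraph P p E) :
    Bdep P α K (equalSplit E) =
      ∑ n : Fin d → Fin 2,
        (∏ j, (∏ i, (1 - p i j)) ^ (n j : ℕ) * (1 - ∏ i, (1 - p i j)) ^ (1 - (n j : ℕ))) *
          (∑ j, K j ^ (1 / α) * ((n j : ℕ) : ℝ)) ^ α := by
  set N : Ω → Fin d → Fin 2 := fun ω j => (isolated E j).indicator (fun _ => (1 : Fin 2)) ω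
    with hN
  have hNm : Measurable N := measurable_pi_lambda _ fun j =>
    measurable_const.indicator (hE.measurableSet_isolated j)
  have hshare : ∀ ω j, uninsuredShare (equalSplit E) ω j = ((N ω j : ℕ) : ℝ) := fun ω j => by
    rw [uninsuredShare_equalSplit]
    by_cases h : ω ∈ isolated E j <;> simp [hN, h]
  have := Measure.isProbabilityMeasure_map (μ := P) hNm.aemeasurable
  simp only [Bdep, hshare]
  rw [← integral_map (φ := N) (f := fun n => (∑ j, K j ^ (1 / α) * ((n j : ℕ) : ℝ)) ^ α)
    hNm.aemeasurable (measurable_of_finite _).aestronglyMeasurable,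
    integral_fintype (Integrable.of_finite)]
  refine Finset.sum_congr rfl fun n _ => ?_
  rw [map_measureReal_apply hNm (measurableSet_singleton n), hE.measureReal_pattern, smul_eq_mul]

end

end ReinsuranceNetwork

open ReinsuranceNetwork in
theorem proposition3p5 {Ω : Type*} [MeasurableSpace Ω] (P : Measure Ω) [IsProbabilityMeasure P]
    {q d : ℕ} (p : Fin q → Fin d → ℝ) (E : Fin q → Fin d → Set Ω)
    (hE : IsRandomBipartiteGraph P p E)
    (α : ℝ) (hα : 0 < α) (K : Fin d → ℝ) (hK : ∀ j, 0 < K j)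
    (V : Ω → Fin d → ℝ) (ν : Measure (PuncturedOrthant d)) (hV : IsParetoClaims P V α K ν)
    (hEV : IndepFun (edge E) V P) :
    -- general weights
    (∀ W : Ω → Fin q → Fin d → ℝ, Measurable W →
      (∀ᵐ ω ∂P, ∀ i j, 0 ≤ W ω i j) →
      (∀ᵐ ω ∂P, ∀ j, 0 < ∑ i, W ω i j ∧ ∑ i, W ω i j ≤ 1) →
      IndepFun (marketMatrix E W) V P →
        (AsympIndependent ν →
          UninsuredTail P (marketMatrix E W) V α (Bind P α K (marketMatrix E W))) ∧
        (AsympFullyDependent α K ν →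
          UninsuredTail P (marketMatrix E W) V α (Bdep P α K (marketMatrix E W)))) ∧
    -- equal splitting
    (AsympIndependent ν →
      UninsuredTail P (equalSplit E) V α (Bind P α K (equalSplit E))) ∧
    (AsympFullyDependent α K ν →
      UninsuredTail P (equalSplit E) V α (Bdep P α K (equalSplit E))) ∧
    Bind P α K (equalSplit E) = ∑ j, K j * ∏ i, (1 - p i j) ∧
    Bdep P α K (equalSplit E) =
      ∑ n : Fin d → Fin 2,
        (∏ j, (∏ i, (1 - p i j)) ^ (n j : ℕ) * (1 - ∏ i, (1 - p i j)) ^ (1 - (n j : ℕ))) *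
          (∑ j, K j ^ (1 / α) * ((n j : ℕ) : ℝ)) ^ α := by
  have hsplit : IndepFun (equalSplit E) V P :=
    hEV.comp (φ := fun (e : Fin q → Fin d → ℝ) i j => e i j / ∑ i', e i' j) (ψ := id)
      (by fun_prop) measurable_id
  have hsplit_meas : Measurable (equalSplit E) := by
    have := measurable_edge hE.measurableSet
    unfold equalSplit deg
    fun_prop
  have hsplit_share : ∀ᵐ ω ∂P, ∀ j, uninsuredShare (equalSplit E) ω j ∈ Set.Icc (0 : ℝ) 1 :=
    ae_of_all _ fun ω j => by
      rw [uninsuredShare_equalSplit]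
      by_cases h : ω ∈ isolated E j <;> simp [h]
  have htail := hV.uninsuredTail hα hK hsplit_meas hsplit_share hsplit
  refine ⟨fun W hW hW0 hW1 hWV => ?_, htail.1, htail.2, hE.bind_equalSplit hα,
    hE.bdep_equalSplit⟩
  refine hV.uninsuredTail hα hK (measurable_marketMatrix hE.measurableSet hW) ?_ hWV
  filter_upwards [hW0, hW1] with ω h0 h1 j
  exact uninsuredShare_marketMatrix_mem_Icc (fun i => h0 i j) (h1 j).2
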